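/- For a matrix $A\in\mathbb C^{n\times n}$ and a function $g$ analytic on an open set containing the spectrum $\sigma(A)$, let $$g(A)=\frac1{2\pi i}\int_\Gamma g(\lambda)(\lambda\mathbf 1-A)^{-1}\,d\lambda ,$$ where the contour $\Gamma$ lies in the domain of $g$ and encloses $\sigma(A)$ (for example, small positively oriented circles around the eigenvalues). Let $f$ be analytic on an open disc of radius $R>0$ centered at $z_0\in\mathbb C$, and let $A\in\mathbb C^{n\times n}$ be a matrix whose spectrum $\sigma(A)$ is contained in this disc. Let $L,M\ge 0$ be integers, let $N=L+M+1$, and let $r=u/v$ be a Padé approximant of $f$ of degree $[L/M]$ at $z_0$; that is, $u$ and $v$ are complex polynomials with $\deg u\le L$, $\deg v\le M$, $v(z_0)\ne0$, and $$r^{(j)}(z_0)=f^{(j)}(z_0),\qquad j=0,1,\dots,L+M .$$ Assume that $v(\lambda)\neq0$ for all $\lambda\in\sigma(A)$. Then, for any norm $\lVert\cdot\rVert$ on the complex linear space $\mathbb C^{n\times n}$, the maximum below is attained and $$\bigl\lVert f(A)-r(A)\bigr\rVert\le\max_{t\in[0,1]}\Bigl\lVert (A-z_0\mathbf1)^N[v(A)]^{-1}\,\frac{(vf)^{(N)}\bigl((1-t)z_0\mathbf1+tA\bigr)}{N!}\Bigr\rVert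 .$$ -/

import Mathlib

open Filter Topology Polynomial

noncomputable section

/-- The contour integral `(1 / 2πi) ∫_Γ g(z) (z 1 - A)⁻¹ dz` (computed entrywise), where `Γ` is the
union of the positively oriented circles of radius `ε` centred at the eigenvalues of `A`. -/
def contourFunction {n : ℕ} (g : ℂ → ℂ) (A : Matrix (Fin n) (Fin n) ℂ) (ε : ℝ) :
    Matrix (Fin n) (Fin n) ℂ :=
  Matrix.of fun i j =>
    (2 * Real.pi * Complex.I)⁻¹ *
      ∑ μ ∈ A.finite_spectrum.toFinset, ∮ z in C(μ, ε), g z * (z • (1 : Matrix (Fin n) (Fin n) ℂ) - A)⁻¹ i j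

/-- The function `g` applied to the matrix `A`: the value of the contour integral above for all
sufficiently small radii `ε`. If `g` is analytic at every eigenvalue of `A`, the
integral does not depend on `ε` once `ε` is small (`contourFunction_eventually_eq`), and for small
`ε` the contour lies in the domain of analyticity of `g` and encloses the spectrum of `A`. -/
def matrixFunction {n : ℕ} (g : ℂ → ℂ) (A : Matrix (Fin n) (Fin n) ℂ) :
    Matrix (Fin n) (Fin n) ℂ :=
  limUnder (𝓝[>] (0 : ℝ)) (contourFunction g A)

/-- The rational function `u / v` is a Padé approximant of degree `[L/M]` of `f` at `z₀`:
it interpolates `f` at the single point `z₀` with multiplicity `L + M + 1`. -/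
structure IsPadeApproximant (f : ℂ → ℂ) (z₀ : ℂ) (L M : ℕ) (u v : ℂ[X]) : Prop where
  natDegree_num_le : u.natDegree ≤ L
  natDegree_den_le : v.natDegree ≤ M
  den_ne_zero : v.eval z₀ ≠ 0
  interpolates : ∀ j < L + M + 1,
    iteratedDeriv j (fun z => u.eval z / v.eval z) z₀ = iteratedDeriv j f z₀

lemma differentiableAt_inv_apply {n : ℕ} (A : Matrix (Fin n) (Fin n) ℂ) {z : ℂ}
    (hz : z ∉ spectrum ℂ A) (i j : Fin n) :
    DifferentiableAt ℂ (fun w : ℂ => (w • (1 : Matrix (Fin n) (Fin n) ℂ) - A)⁻¹ i j) z := by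
  have hdet : (z • (1 : Matrix (Fin n) (Fin n) ℂ) - A).det ≠ 0 := by
    rw [spectrum.notMem_iff, Algebra.algebraMap_eq_smul_one, Matrix.isUnit_iff_isUnit_det] at hz
    exact hz.ne_zero
  have hpoly : ∀ B : Matrix (Fin n) (Fin n) ℂ[X],
      Differentiable ℂ (fun w : ℂ => (B.map (Polynomial.eval w)).det) := by
    intro B
    have : (fun w : ℂ => (B.map (Polynomial.eval w)).det) = fun w => B.det.eval w := by
      funext w
      have := RingHom.map_det (Polynomial.evalRingHom w) B
      simpa [RingHom.mapMatrix_apply] using this.symm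
    rw [this]
    exact B.det.differentiable
  have hd : ∀ w : ℂ, (w • (1 : Matrix (Fin n) (Fin n) ℂ) - A)
      = A.charmatrix.map (Polynomial.eval w) := by
    intro w
    ext a b
    by_cases h : a = b
    · subst h; simp
    · simp [h]
  have hadj : Differentiable ℂ
      (fun w : ℂ => (w • (1 : Matrix (Fin n) (Fin n) ℂ) - A).adjugate i j) := by
    have : (fun w : ℂ => (w • (1 : Matrix (Fin n) (Fin n) ℂ) - A).adjugate i j)
        = fun w => (A.charmatrix.adjugate i j).eval w := by
      funext w
      rw [hd]
      have := RingHom.map_adjugate (Polynomial.evalRingHom w) A.charmatrix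
      have := congrFun (congrFun this i) j
      simpa [RingHom.mapMatrix_apply] using this.symm
    rw [this]
    exact (A.charmatrix.adjugate i j).differentiable
  have hD : Differentiable ℂ (fun w : ℂ => (w • (1 : Matrix (Fin n) (Fin n) ℂ) - A).det) := by
    simp_rw [hd]
    exact hpoly _
  have : (fun w : ℂ => (w • (1 : Matrix (Fin n) (Fin n) ℂ) - A)⁻¹ i j)
      = fun w => ((w • (1 : Matrix (Fin n) (Fin n) ℂ) - A).det)⁻¹ *
          (w • (1 : Matrix (Fin n) (Fin n) ℂ) - A).adjugate i j := by
    funext w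
    simp [Matrix.inv_def]
  rw [this]
  exact (hD.differentiableAt.inv hdet).mul hadj.differentiableAt

/-- Well-definedness of `matrixFunction`. -/
theorem contourFunction_eventually_eq {n : ℕ} (g : ℂ → ℂ) (A : Matrix (Fin n) (Fin n) ℂ)
    (hg : ∀ μ ∈ spectrum ℂ A, AnalyticAt ℂ g μ) :
    ∀ᶠ ε in 𝓝[>] (0 : ℝ), contourFunction g A ε = matrixFunction g A := by
  have hloc : ∀ μ ∈ A.finite_spectrum.toFinset, ∀ᶠ δ in 𝓝[>] (0 : ℝ),
      ∀ z ∈ Metric.closedBall μ δ, z ≠ μ → DifferentiableAt ℂ g z ∧ z ∉ spectrum ℂ A := by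
    intro μ hμ
    have h1 : ∀ᶠ z in 𝓝 μ, DifferentiableAt ℂ g z :=
      (hg μ (by simpa using hμ)).eventually_analyticAt.mono fun z hz => hz.differentiableAt
    have h2 : ∀ᶠ z in 𝓝 μ, z ≠ μ → z ∉ spectrum ℂ A := by
      have hc : IsClosed (spectrum ℂ A \ {μ}) := (A.finite_spectrum.subset Set.sdiff_subset).isClosed
      filter_upwards [hc.isOpen_compl.mem_nhds (x := μ) (by simp)] with z hz hzμ hzA
      exact hz ⟨hzA, hzμ⟩
    obtain ⟨r, hr, hball⟩ := Metric.eventually_nhds_iff_ball.1 (h1.and h2)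
    filter_upwards [Ioo_mem_nhdsGT hr] with δ hδ z hz hzμ
    have := hball z (Metric.closedBall_subset_ball hδ.2 hz)
    exact ⟨this.1, this.2 hzμ⟩
  have hall := (A.finite_spectrum.toFinset.eventually_all).2 hloc
  obtain ⟨δ, hδ, hδ0⟩ := (hall.and self_mem_nhdsWithin).exists
  have hδ0 : 0 < δ := hδ0
  have hconst : ∀ ε ∈ Set.Ioc 0 δ, contourFunction g A ε = contourFunction g A δ := by
    intro ε hε
    ext i j
    simp only [contourFunction, Matrix.of_apply]
    congr 1
    refine Finset.sum_congr rfl fun μ hμ => ?_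
    have hd : ∀ z ∈ Metric.closedBall μ δ \ Metric.ball μ ε, DifferentiableAt ℂ
        (fun z => g z * (z • (1 : Matrix (Fin n) (Fin n) ℂ) - A)⁻¹ i j) z := by
      intro z hz
      have hne : z ≠ μ := by
        rintro rfl
        exact hz.2 (Metric.mem_ball_self hε.1)
      have := hδ μ hμ z hz.1 hne
      exact this.1.mul (differentiableAt_inv_apply A this.2 i j)
    exact (Complex.circleIntegral_eq_of_differentiable_on_annulus_off_countable hε.1 hε.2
      Set.countable_empty (fun z hz => (hd z hz).continuousAt.continuousWithinAt)
      (fun z hz => hd z ⟨Metric.ball_subset_closedBall hz.1.1,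
        fun h => hz.1.2 (Metric.ball_subset_closedBall h)⟩)).symm
  have hev : ∀ᶠ ε in 𝓝[>] (0 : ℝ), contourFunction g A ε = contourFunction g A δ := by
    filter_upwards [Ioc_mem_nhdsGT hδ0] with ε hε using hconst ε hε
  have hlim : matrixFunction g A = contourFunction g A δ :=
    (tendsto_const_nhds.congr' (hev.mono fun _ h => h.symm)).limUnder_eq
  rw [hlim]
  exact hev

end

/-! Partial fractions turn the contour integral for `g(A)` into residues, so `g(A)` depends only
on the jets of `g` at the eigenvalues of `A`; the rules for `g(A)`, including its derivative along
a segment of matrices, therefore reduce to those for polynomials. Let `G = v f - u`, which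
vanishes at `z₀` to order `N`, and `D = A - z₀`. Then `F j t = D ^ j * G⁽ʲ⁾(z₀ + t D)` satisfies
`dF j/dt = F (j + 1)` and `F j 0 = 0` for `j < N`. The mean value theorem fails for matrix-valued
curves, but a real functional that norms `F 0 1 = G(A)` (Hahn–Banach) makes the `F j` scalar, and
Taylor's theorem with Lagrange remainder bounds the norm of `G(A)` by that of `F N t / N!` for
some `t`. The norm `B ↦ ‖v(A)⁻¹ B‖` in place of `‖·‖` gives the estimate, as `v(A) (f(A) - r(A)) =
G(A)` and `G⁽ᴺ⁾ = (v f)⁽ᴺ⁾`. -/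

section Real

theorem exists_eq_mul_pow_div_factorial {h : ℕ → ℝ → ℝ} {N : ℕ} {x : ℝ} (hx : 0 < x)
    (hderiv : ∀ j < N, ∀ t ∈ Set.Icc 0 x, HasDerivAt (h j) (h (j + 1) t) t)
    (hzero : ∀ j < N, h j 0 = 0) : ∃ t ∈ Set.Icc 0 x, h 0 x = h N t * (x ^ N / N.factorial) := by
  induction N generalizing h x with
  | zero => exact ⟨x, Set.right_mem_Icc.2 hx.le, by simp⟩
  | succ N ih =>
    obtain ⟨y, hy, hratio⟩ := exists_ratio_hasDerivAt_eq_ratio_slope (h 0) (h 1) hx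
      (fun t ht => (hderiv 0 N.succ_pos t ht).continuousAt.continuousWithinAt)
      (fun t ht => hderiv 0 N.succ_pos t (Set.Ioo_subset_Icc_self ht)) (fun t => t ^ (N + 1))
      (fun t => (N + 1 : ℕ) * t ^ N) (by fun_prop) (fun t _ => hasDerivAt_pow (N + 1) t)
    obtain ⟨t, ht, hty⟩ := ih (h := fun j => h (j + 1)) hy.1
      (fun j hj t ht => hderiv (j + 1) (by omega) t ⟨ht.1, ht.2.trans hy.2.le⟩)
      (fun j hj => hzero (j + 1) (by omega))
    refine ⟨t, ⟨ht.1, ht.2.trans hy.2.le⟩, ?_⟩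
    have hfac := Nat.factorial_ne_zero N
    have hyN : y ^ N ≠ 0 := pow_ne_zero N hy.1.ne'
    simp only [zero_add] at hty
    rw [hty, hzero 0 N.succ_pos, zero_pow N.succ_ne_zero, sub_zero, sub_zero] at hratio
    refine mul_right_cancel₀ (mul_ne_zero (Nat.cast_ne_zero (R := ℝ).2 N.succ_ne_zero) hyN) ?_
    rw [← hratio, Nat.factorial_succ]
    push_cast
    field_simp

theorem exists_dual_apply_eq_seminorm {E : Type*} [AddCommGroup E] [Module ℝ E] (p : Seminorm ℝ E)
    (x : E) : ∃ φ : Module.Dual ℝ E, φ x = p x ∧ ∀ y, |φ y| ≤ p y := by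
  rcases eq_or_ne x 0 with rfl | hx
  · exact ⟨0, by simp⟩
  let f : E →ₗ.[ℝ] ℝ := LinearPMap.mkSpanSingleton x (p x) hx
  have hf (c : ℝ) (hc : c • x ∈ f.domain) : f ⟨c • x, hc⟩ = c * p x :=
    LinearPMap.mkSpanSingleton'_apply ..
  obtain ⟨φ, hφ, hle⟩ := exists_extension_of_le_sublinear f p
    (fun c hc y => by simp [map_smul_eq_mul, abs_of_pos hc]) (map_add_le_add p) (by
      rintro ⟨y, hy⟩
      obtain ⟨c, rfl⟩ := Submodule.mem_span_singleton.1 hy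
      rw [hf, map_smul_eq_mul]
      exact mul_le_mul_of_nonneg_right (le_abs_self c) (apply_nonneg p x))
  refine ⟨φ, ?_, p.abs_le_of_le hle⟩
  simpa using (hφ ⟨(1 : ℝ) • x, Submodule.smul_mem _ 1 (Submodule.mem_span_singleton_self x)⟩).trans
    (hf 1 _)

theorem continuous_seminorm_of_finiteDimensional {E : Type*} [NormedAddCommGroup E]
    [NormedSpace ℝ E] [FiniteDimensional ℝ E] (p : Seminorm ℝ E) : Continuous p :=
  continuousOn_univ.1 (p.convexOn.continuousOn isOpen_univ)

end Real

section Spectrum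

variable {K : Type*} [Field K] {ι : Type*} [Fintype ι] [DecidableEq ι]

theorem add_mem_of_mem_spectrum_sub_smul_one {A : Matrix ι ι K} {x μ : K}
    (hμ : μ ∈ spectrum K (A - x • 1)) : x + μ ∈ spectrum K A := by
  simpa [Algebra.algebraMap_eq_smul_one, add_comm x] using (spectrum.add_mem_add_iff (s := x)).2 hμ

theorem commute_sub_smul_one_inv_aeval (A : Matrix ι ι K) (x : K) (p : K[X]) :
    Commute (A - x • 1) (aeval A p)⁻¹ := by
  have hsub : aeval A (X - C x) = A - x • 1 := by simp [Algebra.algebraMap_eq_smul_one]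
  have hcomm : Commute (A - x • 1) (aeval A p) := hsub ▸ (Commute.all (X - C x) p).map (aeval A)
  simpa using Matrix.Commute.zpow_right hcomm (-1)

variable [IsAlgClosed K]

theorem spectrum_aeval (A : Matrix ι ι K) (p : K[X]) :
    spectrum K (aeval A p) = (fun z => p.eval z) '' spectrum K A := by
  cases isEmpty_or_nonempty ι
  · simp [spectrum.of_subsingleton]
  exact spectrum.map_polynomial_aeval_of_nonempty A p
    (spectrum.nonempty_of_isAlgClosed_of_finiteDimensional K A)

theorem spectrum_smul_one_add_smul (A : Matrix ι ι K) (a b : K) :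
    spectrum K (b • 1 + a • A) = (fun z => b + a * z) '' spectrum K A := by
  have hspec := spectrum_aeval A (C b + C a * X)
  simp only [map_add, map_mul, aeval_C, aeval_X, Algebra.algebraMap_eq_smul_one, smul_mul_assoc,
    one_mul, eval_add, eval_C, eval_mul, eval_X] at hspec
  exact hspec

theorem isUnit_det_aeval {A : Matrix ι ι K} {p : K[X]} (hp : ∀ μ ∈ spectrum K A, p.eval μ ≠ 0) :
    IsUnit (aeval A p).det := by
  rw [← Matrix.isUnit_iff_isUnit_det, ← spectrum.zero_notMem_iff K, spectrum_aeval]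
  rintro ⟨μ, hμ, hzero⟩
  exact hp μ hμ hzero

end Spectrum

section Polynomial

variable {K : Type*} [Field K] [CharZero K]

theorem X_sub_C_pow_dvd_iff_iterate_derivative {p : K[X]} {μ : K} {m : ℕ} :
    (X - C μ) ^ m ∣ p ↔ ∀ k < m, (derivative^[k] p).eval μ = 0 := by
  rcases eq_or_ne p 0 with rfl | hp
  · simp
  cases m with
  | zero => simp
  | succ m =>
    rw [← le_rootMultiplicity_iff hp, Nat.succ_le_iff,
      lt_rootMultiplicity_iff_isRoot_iterate_derivative hp]
    simp [IsRoot]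

theorem eval_iterate_derivative_taylorSum (c : ℕ → K) (μ : K) {m k : ℕ} (hk : k < m) :
    (derivative^[k] (∑ j ∈ Finset.range m, C (c j / j.factorial) * (X - C μ) ^ j)).eval μ =
      c k := by
  have hterm (j : ℕ) : (derivative^[k] (C (c j / j.factorial) * (X - C μ) ^ j)).eval μ =
      if j = k then c k else 0 := by
    rw [iterate_derivative_C_mul, iterate_derivative_X_sub_pow]
    rcases lt_trichotomy j k with h | rfl | h
    · simp [Nat.descFactorial_of_lt h, h.ne]
    · simp [Nat.descFactorial_self, Nat.factorial_ne_zero]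
    · simp [h.ne', Nat.sub_ne_zero_of_lt h]
  rw [iterate_derivative_sum, eval_finsetSum]
  simp only [hterm, Finset.sum_ite_eq', Finset.mem_range, if_pos hk]

theorem exists_hermite_interpolant (S : Finset K) (m : ℕ) (c : K → ℕ → K) :
    ∃ p : K[X], ∀ μ ∈ S, ∀ k < m, (derivative^[k] p).eval μ = c μ k := by
  have hcoprime : Pairwise (Function.onFun IsCoprime
      fun μ : S => Ideal.span {(X - C (μ : K)) ^ m}) := fun μ ν hμν => by
    rw [Function.onFun, Ideal.isCoprime_span_singleton_iff]
    exact (isCoprime_X_sub_C_of_isUnit_sub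
      (sub_ne_zero.2 (Subtype.coe_injective.ne hμν)).isUnit).pow
  obtain ⟨p, hp⟩ := Ideal.exists_forall_sub_mem_ideal hcoprime fun μ =>
    ∑ j ∈ Finset.range m, C (c μ j / j.factorial) * (X - C (μ : K)) ^ j
  refine ⟨p, fun μ hμ k hk => ?_⟩
  have h := X_sub_C_pow_dvd_iff_iterate_derivative.1
    (Ideal.mem_span_singleton.1 (hp ⟨μ, hμ⟩)) k hk
  rw [iterate_derivative_sub, eval_sub, eval_iterate_derivative_taylorSum _ _ hk] at h
  exact sub_eq_zero.1 h

theorem dvd_of_eval_iterate_derivative_eq_zero [IsAlgClosed K] {p q : K[X]} (hq : q ≠ 0)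
    (h : ∀ μ, q.IsRoot μ → ∀ k < q.natDegree, (derivative^[k] p).eval μ = 0) : q ∣ p := by
  classical
  rcases eq_or_ne p 0 with rfl | hp
  · exact dvd_zero q
  rw [IsAlgClosed.dvd_iff_roots_le_roots hq hp, Multiset.le_iff_count]
  intro μ
  by_cases hμ : q.IsRoot μ
  · calc q.roots.count μ ≤ q.natDegree := (Multiset.count_le_card μ _).trans q.card_roots'
      _ ≤ p.roots.count μ := by
        rw [count_roots, le_rootMultiplicity_iff hp, X_sub_C_pow_dvd_iff_iterate_derivative]
        exact h μ hμ
  · rw [count_roots, rootMultiplicity_eq_zero hμ]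
    exact Nat.zero_le _

theorem aeval_eq_of_eval_iterate_derivative_eq [IsAlgClosed K] {ι : Type*} [Fintype ι]
    [DecidableEq ι] (A : Matrix ι ι K) {p q : K[X]}
    (h : ∀ μ ∈ spectrum K A, ∀ k < Fintype.card ι,
      (derivative^[k] p).eval μ = (derivative^[k] q).eval μ) :
    aeval A p = aeval A q := by
  obtain ⟨r, hr⟩ : A.charpoly ∣ p - q := by
    refine dvd_of_eval_iterate_derivative_eq_zero A.charpoly_monic.ne_zero fun μ hμ k hk => ?_
    rw [A.charpoly_natDegree_eq_dim] at hk
    rw [iterate_derivative_sub, eval_sub, sub_eq_zero]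
    exact h μ (A.mem_spectrum_iff_isRoot_charpoly.2 hμ) k hk
  rw [← sub_eq_zero, ← map_sub, hr, map_mul, A.aeval_self_charpoly, zero_mul]

variable [IsAlgClosed K] {ι : Type*} [Fintype ι] [DecidableEq ι]

open Classical in
/-- The component matrix `(A - μ)ᵏ P`, where `P` is the projection onto the generalized eigenspace
of the eigenvalue `μ` of `A` that annihilates the other ones; a polynomial in `A` is the combination
of these matrices with its Taylor coefficients at the eigenvalues. It is encoded as the value at `A`
of a polynomial whose Taylor coefficients of order less than `card ι` at the eigenvalues of `A`
vanish, except for the `k`-th one at `μ`, which is `1`. -/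
noncomputable def componentMatrix (A : Matrix ι ι K) (μ : K) (k : ℕ) : Matrix ι ι K :=
  aeval A (exists_hermite_interpolant A.finite_spectrum.toFinset (Fintype.card ι)
    (Pi.single μ (Pi.single k (k.factorial : K)))).choose

theorem aeval_eq_sum_componentMatrix (A : Matrix ι ι K) (p : K[X]) :
    aeval A p = ∑ μ ∈ A.finite_spectrum.toFinset, ∑ k ∈ Finset.range (Fintype.card ι),
      ((derivative^[k] p).eval μ / k.factorial) • componentMatrix A μ k := by
  classical
  simp_rw [componentMatrix, ← map_smul, ← map_sum]
  refine aeval_eq_of_eval_iterate_derivative_eq A fun ν hν j hj => ?_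
  have hbasis (μ : K) (k : ℕ) := (exists_hermite_interpolant A.finite_spectrum.toFinset
    (Fintype.card ι) (Pi.single μ (Pi.single k (k.factorial : K)))).choose_spec ν
      (A.finite_spectrum.mem_toFinset.2 hν) j hj
  simp_rw [iterate_derivative_sum, eval_finsetSum, iterate_derivative_smul, eval_smul, hbasis]
  rw [Finset.sum_eq_single_of_mem ν (A.finite_spectrum.mem_toFinset.2 hν),
    Finset.sum_eq_single_of_mem j (Finset.mem_range.2 hj)]
  · simp [Nat.factorial_ne_zero]
  · simp +contextual [eq_comm]
  · simp +contextual [eq_comm]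

theorem inv_smul_one_sub_eq_sum_componentMatrix (A : Matrix ι ι K) {z : K}
    (hz : z ∉ spectrum K A) :
    (z • (1 : Matrix ι ι K) - A)⁻¹ =
      ∑ μ ∈ A.finite_spectrum.toFinset, ∑ k ∈ Finset.range (Fintype.card ι),
        (1 / (z - μ) ^ (k + 1)) • componentMatrix A μ k := by
  obtain ⟨p, hp⟩ := exists_hermite_interpolant A.finite_spectrum.toFinset (Fintype.card ι)
    fun μ k => k.factorial / (z - μ) ^ (k + 1)
  simp only [Set.Finite.mem_toFinset] at hp
  have hmul : aeval A ((C z - X) * p) = aeval A (1 : K[X]) := by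
    refine aeval_eq_of_eval_iterate_derivative_eq A fun μ hμ k hk => ?_
    have hzμ : z - μ ≠ 0 := sub_ne_zero.2 fun h => hz (h ▸ hμ)
    have hleibniz : (derivative^[k] ((C z - X) * p)).eval μ =
        (z - μ) * (derivative^[k] p).eval μ - k * (derivative^[k - 1] p).eval μ := by
      rw [sub_mul, mul_comm X, iterate_derivative_sub, iterate_derivative_C_mul,
        iterate_derivative_mul_X]
      simp only [eval_sub, eval_mul, eval_C, eval_add, eval_X, eval_natCast, nsmul_eq_mul]
      ring
    rw [hleibniz, hp μ hμ k hk, hp μ hμ (k - 1) (k.pred_le.trans_lt hk)]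
    cases k with
    | zero => simp [hzμ]
    | succ k =>
      rw [iterate_derivative_one k.succ_pos, eval_zero, Nat.factorial_succ, Nat.add_sub_cancel]
      push_cast
      field_simp
      ring
  have hinv : (z • (1 : Matrix ι ι K) - A)⁻¹ = aeval A p :=
    Matrix.inv_eq_right_inv (by simpa [Algebra.algebraMap_eq_smul_one] using hmul)
  rw [hinv, aeval_eq_sum_componentMatrix]
  refine Finset.sum_congr rfl fun μ hμ => Finset.sum_congr rfl fun k hk => ?_
  rw [hp μ (by simpa using hμ) k (Finset.mem_range.1 hk),
    div_div_cancel_left' (Nat.cast_ne_zero.2 k.factorial_ne_zero), one_div]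

end Polynomial

section Residues

theorem circleIntegral_mul_one_div_sub_pow {g : ℂ → ℂ} {ν μ : ℂ} {ε : ℝ} (hε : 0 < ε)
    (hg : DifferentiableOn ℂ g (Metric.closedBall ν ε)) (hμ : μ ∈ Metric.closedBall ν ε → μ = ν)
    (k : ℕ) :
    ∮ z in C(ν, ε), g z * (1 / (z - μ) ^ (k + 1)) =
      if μ = ν then 2 * Real.pi * Complex.I * (iteratedDeriv k g ν / k.factorial) else 0 := by
  split_ifs with h
  · subst h
    have hcauchy := hg.circleIntegral_one_div_sub_center_pow_smul hε k
    simp only [smul_eq_mul] at hcauchy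
    simp_rw [mul_comm (g _), hcauchy]
    ring
  · have hd : DifferentiableOn ℂ (fun z => g z * (1 / (z - μ) ^ (k + 1)))
        (Metric.closedBall ν ε) := by
      refine hg.mul (DifferentiableOn.div (by fun_prop) (by fun_prop) fun z hz => ?_)
      exact pow_ne_zero _ (sub_ne_zero.2 fun hzμ => h (hμ (hzμ ▸ hz)))
    exact (hd.diffContOnCl_ball subset_rfl).circleIntegral_eq_zero hε.le

theorem circleIntegral_mul_sum_one_div_sub_pow {g : ℂ → ℂ} {S : Finset ℂ} {ν : ℂ} {ε : ℝ}
    (hε : 0 < ε) (hg : DifferentiableOn ℂ g (Metric.closedBall ν ε)) (hν : ν ∈ S)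
    (hS : ∀ μ ∈ S, μ ∈ Metric.closedBall ν ε → μ = ν) (m : ℕ) (a : ℂ → ℕ → ℂ) :
    ∮ z in C(ν, ε), g z * ∑ μ ∈ S, ∑ k ∈ Finset.range m, 1 / (z - μ) ^ (k + 1) * a μ k =
      2 * Real.pi * Complex.I *
        ∑ k ∈ Finset.range m, iteratedDeriv k g ν / k.factorial * a ν k := by
  have hint (μ) (hμ : μ ∈ S) (k : ℕ) :
      CircleIntegrable (fun z => a μ k * (g z * (1 / (z - μ) ^ (k + 1)))) ν ε := by
    have hne : ∀ z ∈ Metric.sphere ν ε, z - μ ≠ 0 := by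
      rintro z hz h
      obtain rfl := sub_eq_zero.1 h
      obtain rfl := hS z hμ (Metric.sphere_subset_closedBall hz)
      simp [hε.ne] at hz
    refine ContinuousOn.circleIntegrable hε.le (continuousOn_const.mul
      ((hg.continuousOn.mono Metric.sphere_subset_closedBall).mul ?_))
    exact ContinuousOn.div (by fun_prop) (by fun_prop) fun z hz => pow_ne_zero _ (hne z hz)
  have hexpand (z : ℂ) :
      g z * ∑ μ ∈ S, ∑ k ∈ Finset.range m, 1 / (z - μ) ^ (k + 1) * a μ k =
        ∑ μ ∈ S, ∑ k ∈ Finset.range m, a μ k * (g z * (1 / (z - μ) ^ (k + 1))) := by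
    simp_rw [Finset.mul_sum]
    exact Finset.sum_congr rfl fun μ _ => Finset.sum_congr rfl fun k _ => by ring
  have hpole (μ) (hμ : μ ∈ S) :
      ∮ z in C(ν, ε), ∑ k ∈ Finset.range m, a μ k * (g z * (1 / (z - μ) ^ (k + 1))) =
        ∑ k ∈ Finset.range m, a μ k *
          if μ = ν then 2 * Real.pi * Complex.I * (iteratedDeriv k g ν / k.factorial) else 0 := by
    simp_rw [circleIntegral.integral_fun_sum fun k _ => hint μ hμ k,
      circleIntegral.integral_const_mul, circleIntegral_mul_one_div_sub_pow hε hg (hS μ hμ)]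
  simp_rw [hexpand]
  rw [circleIntegral.integral_fun_sum fun μ hμ => CircleIntegrable.fun_sum _ fun k _ => hint μ hμ k,
    Finset.sum_congr rfl hpole, Finset.sum_eq_single_of_mem ν hν fun μ _ hμν => by simp [hμν],
    Finset.mul_sum]
  exact Finset.sum_congr rfl fun k _ => by rw [if_pos rfl]; ring

end Residues

section MatrixFunction

variable {n : ℕ} {A : Matrix (Fin n) (Fin n) ℂ} {g h : ℂ → ℂ}

theorem contourFunction_eq_sum_componentMatrix {ε : ℝ} (hε : 0 < ε)
    (hg : ∀ ν ∈ spectrum ℂ A, DifferentiableOn ℂ g (Metric.closedBall ν ε))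
    (hsep : ∀ ν ∈ spectrum ℂ A, ∀ μ ∈ spectrum ℂ A, μ ∈ Metric.closedBall ν ε → μ = ν) :
    contourFunction g A ε = ∑ μ ∈ A.finite_spectrum.toFinset, ∑ k ∈ Finset.range n,
      (iteratedDeriv k g μ / k.factorial) • componentMatrix A μ k := by
  ext i j
  have hresolvent {ν z : ℂ} (hν : ν ∈ spectrum ℂ A) (hz : z ∈ Metric.sphere ν ε) :
      (z • 1 - A)⁻¹ i j =
        ∑ μ ∈ A.finite_spectrum.toFinset, ∑ k ∈ Finset.range n,
          1 / (z - μ) ^ (k + 1) * componentMatrix A μ k i j := by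
    have hzA : z ∉ spectrum ℂ A := by
      intro hzA
      obtain rfl := hsep ν hν z hzA (Metric.sphere_subset_closedBall hz)
      simp [hε.ne] at hz
    simp [inv_smul_one_sub_eq_sum_componentMatrix A hzA, Matrix.sum_apply]
  have hcircle (ν) (hν : ν ∈ A.finite_spectrum.toFinset) :
      ∮ z in C(ν, ε), g z * (z • 1 - A)⁻¹ i j =
        2 * Real.pi * Complex.I * ∑ k ∈ Finset.range n,
          iteratedDeriv k g ν / k.factorial * componentMatrix A ν k i j := by
    rw [← circleIntegral_mul_sum_one_div_sub_pow hε (hg ν (by simpa using hν)) hν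
      (fun μ hμ => hsep ν (by simpa using hν) μ (by simpa using hμ)) n
      fun μ k => componentMatrix A μ k i j]
    exact circleIntegral.integral_congr hε.le fun z hz => by
      rw [← hresolvent (by simpa using hν) hz]
  rw [contourFunction, Matrix.of_apply, Finset.sum_congr rfl hcircle, ← Finset.mul_sum,
    inv_mul_cancel_left₀ Complex.two_pi_I_ne_zero]
  simp [Matrix.sum_apply]

theorem eventually_differentiableOn_closedBall {x : ℂ} (hg : AnalyticAt ℂ g x) :
    ∀ᶠ ε in 𝓝[>] (0 : ℝ), DifferentiableOn ℂ g (Metric.closedBall x ε) := by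
  obtain ⟨r, hr, hball⟩ := Metric.eventually_nhds_iff_ball.1 hg.eventually_analyticAt
  filter_upwards [Ioo_mem_nhdsGT hr] with ε hε z hz
  exact (hball z (Metric.closedBall_subset_ball hε.2 hz)).differentiableAt.differentiableWithinAt

theorem eventually_eq_of_mem_closedBall {X : Type*} [MetricSpace X] {S : Set X} (hS : S.Finite)
    (x : X) : ∀ᶠ ε in 𝓝[>] (0 : ℝ), ∀ y ∈ S, y ∈ Metric.closedBall x ε → y = x := by
  refine hS.eventually_all.2 fun y _ => ?_
  rcases eq_or_ne y x with rfl | hy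
  · simp
  filter_upwards [Ioo_mem_nhdsGT (dist_pos.2 hy)] with ε hε hyε
  exact absurd (Metric.mem_closedBall.1 hyε) hε.2.not_ge

theorem matrixFunction_eq_sum_componentMatrix (hg : AnalyticOnNhd ℂ g (spectrum ℂ A)) :
    matrixFunction g A = ∑ μ ∈ A.finite_spectrum.toFinset, ∑ k ∈ Finset.range n,
      (iteratedDeriv k g μ / k.factorial) • componentMatrix A μ k := by
  have hdiff : ∀ᶠ ε in 𝓝[>] (0 : ℝ), ∀ ν ∈ spectrum ℂ A,
      DifferentiableOn ℂ g (Metric.closedBall ν ε) :=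
    A.finite_spectrum.eventually_all.2 fun ν hν => eventually_differentiableOn_closedBall (hg ν hν)
  have hsep : ∀ᶠ ε in 𝓝[>] (0 : ℝ), ∀ ν ∈ spectrum ℂ A, ∀ μ ∈ spectrum ℂ A,
      μ ∈ Metric.closedBall ν ε → μ = ν :=
    A.finite_spectrum.eventually_all.2 fun ν _ =>
      eventually_eq_of_mem_closedBall A.finite_spectrum ν
  obtain ⟨ε, hε, hεdiff, hεsep, hεeq⟩ := (eventually_mem_nhdsWithin.and
    (hdiff.and (hsep.and (contourFunction_eventually_eq g A hg)))).exists
  rw [← hεeq, contourFunction_eq_sum_componentMatrix hε hεdiff hεsep]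

/-- Two functions have the same `m`-jets on `S`: their derivatives of order less than `m` agree at
every point of `S`. -/
def JetEqOn (m : ℕ) (S : Set ℂ) (g h : ℂ → ℂ) : Prop :=
  ∀ μ ∈ S, ∀ k < m, iteratedDeriv k g μ = iteratedDeriv k h μ

theorem analyticAt_iteratedDeriv {x : ℂ} (hg : AnalyticAt ℂ g x) (k : ℕ) :
    AnalyticAt ℂ (iteratedDeriv k g) x :=
  iteratedDeriv_eq_iterate (𝕜 := ℂ) (f := g) ▸ hg.iterated_deriv k

theorem iteratedDeriv_eval (p : ℂ[X]) (k : ℕ) :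
    iteratedDeriv k (fun z => p.eval z) = fun z => (derivative^[k] p).eval z := by
  induction k with
  | zero => simp
  | succ k ih =>
    rw [iteratedDeriv_succ, ih, Function.iterate_succ_apply']
    exact funext fun z => Polynomial.deriv _

theorem analyticOnNhd_eval (p : ℂ[X]) (S : Set ℂ) : AnalyticOnNhd ℂ (fun z => p.eval z) S :=
  fun _ _ => p.differentiable.analyticAt _

theorem exists_jetEqOn_eval {S : Set ℂ} (hS : S.Finite) (m : ℕ) (g : ℂ → ℂ) :
    ∃ p : ℂ[X], JetEqOn m S g (fun z => p.eval z) := by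
  obtain ⟨p, hp⟩ := exists_hermite_interpolant hS.toFinset m fun μ k => iteratedDeriv k g μ
  refine ⟨p, fun μ hμ k hk => ?_⟩
  rw [iteratedDeriv_eval]
  exact (hp μ (hS.mem_toFinset.2 hμ) k hk).symm

theorem iteratedDeriv_comp_affine (g : ℂ → ℂ) (a b : ℂ) (k : ℕ) :
    iteratedDeriv k (fun z => g (b + a * z)) = fun z => a ^ k * iteratedDeriv k g (b + a * z) := by
  induction k with
  | zero => simp
  | succ k ih =>
    funext z
    rw [iteratedDeriv_succ, ih, deriv_const_mul_field,
      deriv_comp_mul_left a fun w => iteratedDeriv k g (b + w), deriv_comp_const_add,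
      ← iteratedDeriv_succ, pow_succ, smul_eq_mul, mul_assoc]

namespace JetEqOn

variable {m : ℕ} {S : Set ℂ} {g₁ g₂ h₁ h₂ : ℂ → ℂ}

theorem mul (hg₁ : AnalyticOnNhd ℂ g₁ S) (hg₂ : AnalyticOnNhd ℂ g₂ S) (hh₁ : AnalyticOnNhd ℂ h₁ S)
    (hh₂ : AnalyticOnNhd ℂ h₂ S) (hg : JetEqOn m S g₁ g₂) (hh : JetEqOn m S h₁ h₂) :
    JetEqOn m S (fun z => g₁ z * h₁ z) (fun z => g₂ z * h₂ z) := fun μ hμ k hk => by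
  rw [iteratedDeriv_fun_mul (hg₁ μ hμ).contDiffAt (hh₁ μ hμ).contDiffAt,
    iteratedDeriv_fun_mul (hg₂ μ hμ).contDiffAt (hh₂ μ hμ).contDiffAt]
  refine Finset.sum_congr rfl fun i hi => ?_
  rw [hg μ hμ i (by grind), hh μ hμ (k - i) (by grind)]

theorem comp_affine {a b : ℂ} (h : JetEqOn m ((fun z => b + a * z) '' S) g₁ g₂) :
    JetEqOn m S (fun z => g₁ (b + a * z)) (fun z => g₂ (b + a * z)) := fun μ hμ k hk => by
  simp only [iteratedDeriv_comp_affine, h _ (Set.mem_image_of_mem _ hμ) k hk]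

end JetEqOn

theorem matrixFunction_eq_aeval {p : ℂ[X]} (hg : AnalyticOnNhd ℂ g (spectrum ℂ A))
    (hp : JetEqOn n (spectrum ℂ A) g (fun z => p.eval z)) :
    matrixFunction g A = aeval A p := by
  rw [matrixFunction_eq_sum_componentMatrix hg, aeval_eq_sum_componentMatrix, Fintype.card_fin]
  refine Finset.sum_congr rfl fun μ hμ => Finset.sum_congr rfl fun k hk => ?_
  rw [hp μ (by simpa using hμ) k (by simpa using hk), iteratedDeriv_eval]

theorem matrixFunction_eval (p : ℂ[X]) (A : Matrix (Fin n) (Fin n) ℂ) :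
    matrixFunction (fun z => p.eval z) A = aeval A p :=
  matrixFunction_eq_aeval (analyticOnNhd_eval p _) fun _ _ _ _ => rfl

theorem matrixFunction_id (A : Matrix (Fin n) (Fin n) ℂ) : matrixFunction (fun z => z) A = A := by
  simpa using matrixFunction_eval X A

theorem matrixFunction_congr (hg : AnalyticOnNhd ℂ g (spectrum ℂ A))
    (hgh : ∀ μ ∈ spectrum ℂ A, g =ᶠ[𝓝 μ] h) : matrixFunction g A = matrixFunction h A := by
  rw [matrixFunction_eq_sum_componentMatrix hg,
    matrixFunction_eq_sum_componentMatrix fun μ hμ => (hg μ hμ).congr (hgh μ hμ)]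
  refine Finset.sum_congr rfl fun μ hμ => Finset.sum_congr rfl fun k _ => ?_
  rw [(hgh μ (by simpa using hμ)).iteratedDeriv_eq k]

theorem matrixFunction_mul (hg : AnalyticOnNhd ℂ g (spectrum ℂ A))
    (hh : AnalyticOnNhd ℂ h (spectrum ℂ A)) :
    matrixFunction (fun z => g z * h z) A = matrixFunction g A * matrixFunction h A := by
  obtain ⟨p, hp⟩ := exists_jetEqOn_eval A.finite_spectrum n g
  obtain ⟨q, hq⟩ := exists_jetEqOn_eval A.finite_spectrum n h
  have hpq := JetEqOn.mul hg (analyticOnNhd_eval p _) hh (analyticOnNhd_eval q _) hp hq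
  simp only [← eval_mul] at hpq
  rw [matrixFunction_eq_aeval hg hp, matrixFunction_eq_aeval hh hq,
    matrixFunction_eq_aeval (hg.mul hh) hpq, map_mul]

theorem matrixFunction_smul_one_add_smul {a b : ℂ}
    (hg : AnalyticOnNhd ℂ g ((fun z => b + a * z) '' spectrum ℂ A)) :
    matrixFunction g (b • 1 + a • A) =
      matrixFunction (fun z => g (b + a * z)) A := by
  obtain ⟨p, hp⟩ := exists_jetEqOn_eval (A.finite_spectrum.image fun z => b + a * z) n g
  have hspec := (spectrum_smul_one_add_smul A a b).subset
  have hcomp : JetEqOn n (spectrum ℂ A) (fun z => g (b + a * z))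
      (fun z => (p.comp (C b + C a * X)).eval z) := by
    simpa using hp.comp_affine
  have hgcomp : AnalyticOnNhd ℂ (fun z => g (b + a * z)) (spectrum ℂ A) := fun μ hμ =>
    (hg _ (Set.mem_image_of_mem _ hμ)).fun_comp (f := fun z => b + a * z) (by fun_prop)
  rw [matrixFunction_eq_aeval (hg.mono hspec) fun μ hμ => hp μ (hspec hμ),
    matrixFunction_eq_aeval hgcomp hcomp, aeval_comp]
  simp [Algebra.algebraMap_eq_smul_one]

section Derivative

open scoped Matrix.Norms.Elementwise

theorem iteratedDeriv_id_mul {x : ℂ} (hh : AnalyticAt ℂ h x) (k : ℕ) :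
    iteratedDeriv k (fun z => z * h z) x =
      x * iteratedDeriv k h x + k * iteratedDeriv (k - 1) h x := by
  rw [iteratedDeriv_fun_mul (f := fun z => z) contDiffAt_id hh.contDiffAt]
  cases k with
  | zero => simp
  | succ k =>
    rw [Finset.sum_range_succ', Finset.sum_range_succ', Finset.sum_eq_zero fun i _ => ?_]
    · simp [iteratedDeriv_fun_id, add_comm]
    · simp [iteratedDeriv_fun_id]

theorem hasDerivAt_iteratedDeriv_comp_affine {b s μ : ℂ} (hg : AnalyticAt ℂ g (b + s * μ)) (k : ℕ) :
    HasDerivAt (fun s => iteratedDeriv k (fun z => g (b + s * z)) μ)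
      (iteratedDeriv k (fun z => z * deriv g (b + s * z)) μ) s := by
  have hderiv : AnalyticAt ℂ (fun z => deriv g (b + s * z)) μ :=
    hg.deriv.fun_comp (f := fun z => b + s * z) (by fun_prop)
  have hline : HasDerivAt (fun s => b + s * μ) μ s := by
    simpa using ((hasDerivAt_id s).mul_const μ).const_add b
  have hjet : HasDerivAt (iteratedDeriv k g) (iteratedDeriv (k + 1) g (b + s * μ)) (b + s * μ) := by
    rw [iteratedDeriv_succ]
    exact (analyticAt_iteratedDeriv hg k).differentiableAt.hasDerivAt
  simp only [iteratedDeriv_id_mul hderiv, iteratedDeriv_comp_affine, ← iteratedDeriv_succ']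
  refine ((hasDerivAt_pow k s).mul (hjet.comp s hline)).congr_deriv ?_
  cases k with
  | zero => simp [mul_comm]
  | succ k =>
    simp only [Nat.add_sub_cancel, Function.comp_apply]
    ring

theorem hasDerivAt_matrixFunction_smul_one_add_smul {b s : ℂ}
    (hg : AnalyticOnNhd ℂ g ((fun z => b + s * z) '' spectrum ℂ A)) :
    HasDerivAt (fun s => matrixFunction g (b • 1 + s • A))
      (A * matrixFunction (deriv g) (b • 1 + s • A)) s := by
  have hsum {s : ℂ} (hs : AnalyticOnNhd ℂ g ((fun z => b + s * z) '' spectrum ℂ A)) :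
      matrixFunction g (b • 1 + s • A) =
        ∑ μ ∈ A.finite_spectrum.toFinset, ∑ k ∈ Finset.range n,
          (iteratedDeriv k (fun z => g (b + s * z)) μ / k.factorial) • componentMatrix A μ k := by
    rw [matrixFunction_smul_one_add_smul hs, matrixFunction_eq_sum_componentMatrix fun μ hμ =>
      (hs _ (Set.mem_image_of_mem _ hμ)).fun_comp (f := fun z => b + s * z) (by fun_prop)]
  have hnear : ∀ᶠ w in 𝓝 s, AnalyticOnNhd ℂ g ((fun z => b + w * z) '' spectrum ℂ A) := by
    simp only [AnalyticOnNhd, Set.forall_mem_image]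
    exact A.finite_spectrum.eventually_all.2 fun μ hμ =>
      (show ContinuousAt (fun w => b + w * μ) s by fun_prop).eventually
        (hg _ (Set.mem_image_of_mem _ hμ)).eventually_analyticAt
  have hderiv : AnalyticOnNhd ℂ (fun z => deriv g (b + s * z)) (spectrum ℂ A) := fun μ hμ =>
    (hg _ (Set.mem_image_of_mem _ hμ)).deriv.fun_comp (f := fun z => b + s * z) (by fun_prop)
  have hmul : A * matrixFunction (deriv g) (b • 1 + s • A) =
      matrixFunction (fun z => z * deriv g (b + s * z)) A := by
    rw [matrixFunction_smul_one_add_smul hg.deriv,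
      matrixFunction_mul (g := fun z => z) analyticOnNhd_id hderiv, matrixFunction_id]
  rw [hmul, matrixFunction_eq_sum_componentMatrix (analyticOnNhd_id.mul hderiv)]
  refine HasDerivAt.congr_of_eventuallyEq ?_ (hnear.mono fun w hw => hsum hw)
  refine HasDerivAt.fun_sum fun μ hμ => HasDerivAt.fun_sum fun k _ => ?_
  have hgμ := hg _ (Set.mem_image_of_mem _ (A.finite_spectrum.mem_toFinset.1 hμ))
  exact ((hasDerivAt_iteratedDeriv_comp_affine hgμ k).div_const _).smul_const _

theorem matrixFunction_smul_one {x : ℂ} (hg : AnalyticAt ℂ g x) :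
    matrixFunction g (x • (1 : Matrix (Fin n) (Fin n) ℂ)) = g x • 1 := by
  have haffine := matrixFunction_smul_one_add_smul (A := (0 : Matrix (Fin n) (Fin n) ℂ)) (a := 0)
    (b := x) (g := g) (by rintro _ ⟨z, -, rfl⟩; simpa using hg)
  have hconst := matrixFunction_eval (C (g x)) (0 : Matrix (Fin n) (Fin n) ℂ)
  simp only [eval_C] at hconst
  simpa [hconst, Algebra.algebraMap_eq_smul_one] using haffine

theorem image_add_mul_subset_of_starConvex {S U : Set ℂ} {z₀ : ℂ} (hU : StarConvex ℝ z₀ U)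
    (hS : ∀ z ∈ S, z₀ + z ∈ U) {t : ℝ} (ht : t ∈ Set.Icc (0 : ℝ) 1) :
    (fun z => z₀ + t * z) '' S ⊆ U := by
  rintro _ ⟨z, hz, rfl⟩
  simpa using hU.add_smul_mem (hS z hz) ht.1 ht.2

theorem hasDerivAt_matrixFunction_segment {U : Set ℂ} {z₀ : ℂ} (hU : StarConvex ℝ z₀ U)
    (hg : AnalyticOnNhd ℂ g U) (hA : ∀ μ ∈ spectrum ℂ A, z₀ + μ ∈ U) {t : ℝ}
    (ht : t ∈ Set.Icc (0 : ℝ) 1) :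
    HasDerivAt (fun t : ℝ => matrixFunction g (z₀ • 1 + (t : ℂ) • A))
      (A * matrixFunction (deriv g) (z₀ • 1 + (t : ℂ) • A)) t :=
  ((hasDerivAt_matrixFunction_smul_one_add_smul (hg.mono
    (image_add_mul_subset_of_starConvex hU hA ht))).scomp t
    Complex.ofRealCLM.hasDerivAt).congr_deriv (by simp)

theorem exists_seminorm_matrixFunction_le {U : Set ℂ} {z₀ : ℂ} (hU : StarConvex ℝ z₀ U)
    (hz₀ : z₀ ∈ U) (hg : AnalyticOnNhd ℂ g U) {N : ℕ} (hzero : ∀ j < N, iteratedDeriv j g z₀ = 0)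
    {D : Matrix (Fin n) (Fin n) ℂ} (hD : ∀ μ ∈ spectrum ℂ D, z₀ + μ ∈ U)
    (p : Seminorm ℝ (Matrix (Fin n) (Fin n) ℂ)) :
    ∃ t ∈ Set.Icc (0 : ℝ) 1, p (matrixFunction g (z₀ • 1 + D)) ≤
      p (D ^ N * ((N.factorial : ℂ)⁻¹ •
        matrixFunction (iteratedDeriv N g) (z₀ • 1 + (t : ℂ) • D))) := by
  obtain ⟨φ, hφ, hle⟩ := exists_dual_apply_eq_seminorm p (matrixFunction g (z₀ • 1 + D))
  have hjet (j : ℕ) : AnalyticOnNhd ℂ (iteratedDeriv j g) U := fun z hz =>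
    analyticAt_iteratedDeriv (hg z hz) j
  let F (j : ℕ) (t : ℝ) : ℝ := φ (D ^ j * matrixFunction (iteratedDeriv j g)
    (z₀ • 1 + (t : ℂ) • D))
  have hderiv : ∀ j < N, ∀ t ∈ Set.Icc (0 : ℝ) 1, HasDerivAt (F j) (F (j + 1) t) t := by
    intro j _ t ht
    have hpath := hasDerivAt_matrixFunction_segment hU (hjet j) hD ht
    let ψ := (φ ∘ₗ LinearMap.mulLeft ℝ (D ^ j)).toContinuousLinearMap
    refine (ψ.hasFDerivAt.comp_hasDerivAt t hpath).congr_deriv ?_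
    change φ (D ^ j * (D * _)) = φ _
    rw [pow_succ, mul_assoc, iteratedDeriv_succ]
  have hF0 : ∀ j < N, F j 0 = 0 := fun j hj => by
    simp [F, matrixFunction_smul_one (hjet j z₀ hz₀), hzero j hj]
  obtain ⟨t, ht, hFt⟩ := exists_eq_mul_pow_div_factorial one_pos hderiv hF0
  refine ⟨t, ht, ?_⟩
  calc p (matrixFunction g (z₀ • 1 + D)) = F 0 1 := by simp [F, hφ]
    _ = φ (D ^ N * ((N.factorial : ℂ)⁻¹ •
          matrixFunction (iteratedDeriv N g) (z₀ • 1 + (t : ℂ) • D))) := by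
      rw [hFt, Matrix.mul_smul, ← Complex.ofReal_natCast, ← Complex.ofReal_inv, Complex.coe_smul,
        map_smul, smul_eq_mul]
      simp [F, mul_comm]
    _ ≤ _ := (le_abs_self _).trans (hle _)

end Derivative

theorem matrixFunction_sub (hg : AnalyticOnNhd ℂ g (spectrum ℂ A))
    (hh : AnalyticOnNhd ℂ h (spectrum ℂ A)) :
    matrixFunction (fun z => g z - h z) A = matrixFunction g A - matrixFunction h A := by
  have hgh : AnalyticOnNhd ℂ (fun z => g z - h z) (spectrum ℂ A) := hg.sub hh
  rw [matrixFunction_eq_sum_componentMatrix hgh, matrixFunction_eq_sum_componentMatrix hg,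
    matrixFunction_eq_sum_componentMatrix hh]
  simp only [← Finset.sum_sub_distrib, ← sub_smul, ← sub_div]
  refine Finset.sum_congr rfl fun μ hμ => Finset.sum_congr rfl fun k _ => ?_
  have hμ := A.finite_spectrum.mem_toFinset.1 hμ
  rw [iteratedDeriv_fun_sub (hg μ hμ).contDiffAt (hh μ hμ).contDiffAt]

theorem aeval_mul_matrixFunction_sub_div {u v : ℂ[X]} (hg : AnalyticOnNhd ℂ g (spectrum ℂ A))
    (hv : ∀ μ ∈ spectrum ℂ A, v.eval μ ≠ 0) :
    aeval A v * (matrixFunction g A - matrixFunction (fun z => u.eval z / v.eval z) A) =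
      matrixFunction (fun z => v.eval z * g z - u.eval z) A := by
  have hdiv : AnalyticOnNhd ℂ (fun z => u.eval z / v.eval z) (spectrum ℂ A) :=
    (analyticOnNhd_eval u _).div (analyticOnNhd_eval v _) hv
  have hsub : AnalyticOnNhd ℂ (fun z => g z - u.eval z / v.eval z) (spectrum ℂ A) := hg.sub hdiv
  rw [← matrixFunction_sub hg hdiv, ← matrixFunction_eval,
    ← matrixFunction_mul (analyticOnNhd_eval v _) hsub]
  refine matrixFunction_congr ((analyticOnNhd_eval v _).mul hsub) fun μ hμ => ?_
  filter_upwards [(analyticOnNhd_eval v _ μ hμ).continuousAt.eventually_ne (hv μ hμ)] with z hz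
  field_simp

theorem matrixFunction_iteratedDeriv_sub_eval {p : ℂ[X]} {N : ℕ} (hp : p.natDegree < N)
    (hg : AnalyticOnNhd ℂ g (spectrum ℂ A)) :
    matrixFunction (iteratedDeriv N fun z => g z - p.eval z) A =
      matrixFunction (iteratedDeriv N g) A := by
  refine (matrixFunction_congr (fun μ hμ => analyticAt_iteratedDeriv (hg μ hμ) N)
    fun μ hμ => ?_).symm
  filter_upwards [(hg μ hμ).eventually_analyticAt] with z hz
  rw [iteratedDeriv_fun_sub hz.contDiffAt (analyticOnNhd_eval p _ z (Set.mem_univ z)).contDiffAt,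
    iteratedDeriv_eval, iterate_derivative_eq_zero hp]
  simp

end MatrixFunction

theorem IsPadeApproximant.iteratedDeriv_den_mul_sub_num {f : ℂ → ℂ} {z₀ : ℂ} {L M : ℕ} {u v : ℂ[X]}
    (hr : IsPadeApproximant f z₀ L M u v) (hf : AnalyticAt ℂ f z₀) {j : ℕ} (hj : j < L + M + 1) :
    iteratedDeriv j (fun z => v.eval z * f z - u.eval z) z₀ = 0 := by
  have hu : AnalyticAt ℂ (fun z => u.eval z) z₀ := analyticOnNhd_eval u _ z₀ (Set.mem_univ z₀)
  have hv : AnalyticAt ℂ (fun z => v.eval z) z₀ := analyticOnNhd_eval v _ z₀ (Set.mem_univ z₀)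
  have hdiv : AnalyticAt ℂ (fun z => u.eval z / v.eval z) z₀ := hu.div hv hr.den_ne_zero
  have hfactor : (fun z => v.eval z * f z - u.eval z) =ᶠ[𝓝 z₀]
      fun z => v.eval z * (f z - u.eval z / v.eval z) := by
    filter_upwards [hv.continuousAt.eventually_ne hr.den_ne_zero] with z hz
    field_simp
  rw [hfactor.iteratedDeriv_eq,
    iteratedDeriv_fun_mul hv.contDiffAt (hf.fun_sub hdiv).contDiffAt]
  refine Finset.sum_eq_zero fun i _ => ?_
  rw [iteratedDeriv_fun_sub hf.contDiffAt hdiv.contDiffAt, hr.interpolates (j - i) (by omega),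
    sub_self, mul_zero]

theorem IsPadeApproximant.exists_seminorm_matrixFunction_sub_le {f : ℂ → ℂ} {z₀ : ℂ} {L M : ℕ}
    {u v : ℂ[X]} (hr : IsPadeApproximant f z₀ L M u v) {U : Set ℂ} (hU : StarConvex ℝ z₀ U)
    (hz₀ : z₀ ∈ U) (hf : AnalyticOnNhd ℂ f U) {n : ℕ} {A : Matrix (Fin n) (Fin n) ℂ}
    (hA : spectrum ℂ A ⊆ U) (hv : ∀ μ ∈ spectrum ℂ A, v.eval μ ≠ 0) {N : ℕ} (hN : N = L + M + 1)
    (p : Seminorm ℝ (Matrix (Fin n) (Fin n) ℂ)) :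
    ∃ t ∈ Set.Icc (0 : ℝ) 1,
      p (matrixFunction f A - matrixFunction (fun z => u.eval z / v.eval z) A) ≤
        p ((A - z₀ • 1) ^ N * (aeval A v)⁻¹ * ((N.factorial : ℂ)⁻¹ •
          matrixFunction (iteratedDeriv N fun z => v.eval z * f z)
            (z₀ • 1 + (t : ℂ) • (A - z₀ • 1)))) := by
  have hvf : AnalyticOnNhd ℂ (fun z => v.eval z * f z) U := (analyticOnNhd_eval v U).mul hf
  have hu : u.natDegree < N := by have := hr.natDegree_num_le; omega
  have hvfu : AnalyticOnNhd ℂ (fun z => v.eval z * f z - u.eval z) U :=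
    hvf.sub (analyticOnNhd_eval u U)
  obtain ⟨t, ht, hle⟩ := exists_seminorm_matrixFunction_le hU hz₀ hvfu
    (fun j hj => hr.iteratedDeriv_den_mul_sub_num (hf z₀ hz₀) (hN ▸ hj))
    (fun μ hμ => hA (add_mem_of_mem_spectrum_sub_smul_one hμ))
    (p.comp (LinearMap.mulLeft ℝ (aeval A v)⁻¹))
  refine ⟨t, ht, ?_⟩
  have hsegment : spectrum ℂ (z₀ • 1 + (t : ℂ) • (A - z₀ • 1)) ⊆ U :=
    (spectrum_smul_one_add_smul _ _ _).subset.trans (image_add_mul_subset_of_starConvex hU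
      (fun μ hμ => hA (add_mem_of_mem_spectrum_sub_smul_one hμ)) ht)
  calc p (matrixFunction f A - matrixFunction (fun z => u.eval z / v.eval z) A)
    _ = p ((aeval A v)⁻¹ * matrixFunction (fun z => v.eval z * f z - u.eval z) A) := by
      rw [← aeval_mul_matrixFunction_sub_div (hf.mono hA) hv,
        Matrix.nonsing_inv_mul_cancel_left _ _ (isUnit_det_aeval hv)]
    _ ≤ p ((aeval A v)⁻¹ * ((A - z₀ • 1) ^ N * ((N.factorial : ℂ)⁻¹ •
          matrixFunction (iteratedDeriv N fun z => v.eval z * f z - u.eval z)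
            (z₀ • 1 + (t : ℂ) • (A - z₀ • 1))))) := by
      simpa using hle
    _ = p ((A - z₀ • 1) ^ N * (aeval A v)⁻¹ * ((N.factorial : ℂ)⁻¹ •
          matrixFunction (iteratedDeriv N fun z => v.eval z * f z)
            (z₀ • 1 + (t : ℂ) • (A - z₀ • 1)))) := by
      rw [matrixFunction_iteratedDeriv_sub_eval hu (hvf.mono hsegment), ← mul_assoc,
        ((commute_sub_smul_one_inv_aeval A z₀ v).pow_left N).eq]

open scoped Matrix.Norms.Elementwise in
theorem continuousOn_seminorm_matrixFunction_segment {n : ℕ} {C D : Matrix (Fin n) (Fin n) ℂ}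
    {g : ℂ → ℂ} {U : Set ℂ} {z₀ : ℂ} (hU : StarConvex ℝ z₀ U) (hg : AnalyticOnNhd ℂ g U)
    (hD : ∀ μ ∈ spectrum ℂ D, z₀ + μ ∈ U) (c : ℂ) (p : Seminorm ℝ (Matrix (Fin n) (Fin n) ℂ)) :
    ContinuousOn (fun t : ℝ => p (C * (c • matrixFunction g (z₀ • 1 + (t : ℂ) • D))))
      (Set.Icc 0 1) := fun _ ht =>
  ((continuous_seminorm_of_finiteDimensional (p.comp (LinearMap.mulLeft ℝ C))).continuousAt.comp
    ((hasDerivAt_matrixFunction_segment hU hg hD ht).continuousAt.const_smul c)).continuousWithinAt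

theorem corollaryc_general {n : ℕ} (A : Matrix (Fin n) (Fin n) ℂ) (f : ℂ → ℂ) (z₀ : ℂ) (U : Set ℂ)
    (hU : StarConvex ℝ z₀ U) (hz₀ : z₀ ∈ U) (hf : AnalyticOnNhd ℂ f U) (hA : spectrum ℂ A ⊆ U)
    (L M : ℕ) (u v : ℂ[X]) (hr : IsPadeApproximant f z₀ L M u v)
    (hv : ∀ μ ∈ spectrum ℂ A, v.eval μ ≠ 0)
    (p : Seminorm ℝ (Matrix (Fin n) (Fin n) ℂ)) (N : ℕ) (hN : N = L + M + 1) :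
    ∃ m : ℝ,
      IsGreatest
        ((fun t : ℝ =>
            p ((A - z₀ • (1 : Matrix (Fin n) (Fin n) ℂ)) ^ N * (aeval A v)⁻¹ *
              ((N.factorial : ℂ)⁻¹ •
                matrixFunction (iteratedDeriv N (fun z => v.eval z * f z))
                  ((1 - (t : ℂ)) • (z₀ • (1 : Matrix (Fin n) (Fin n) ℂ)) + (t : ℂ) • A)))) ''
          Set.Icc (0 : ℝ) 1) m ∧
      p (matrixFunction f A - matrixFunction (fun z => u.eval z / v.eval z) A) ≤ m := by
  have hsegment (t : ℂ) : (1 - t) • (z₀ • (1 : Matrix (Fin n) (Fin n) ℂ)) + t • A =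
      z₀ • 1 + t • (A - z₀ • 1) := by
    module
  have hvf : AnalyticOnNhd ℂ (iteratedDeriv N fun z => v.eval z * f z) U := fun z hz =>
    analyticAt_iteratedDeriv (((analyticOnNhd_eval v U).mul hf) z hz) N
  simp only [hsegment]
  obtain ⟨m, hm⟩ := (isCompact_Icc.image_of_continuousOn
    (continuousOn_seminorm_matrixFunction_segment hU hvf
      (fun μ hμ => hA (add_mem_of_mem_spectrum_sub_smul_one hμ)) _ p)).exists_isGreatest
        ((Set.nonempty_Icc.2 zero_le_one).image _)
  obtain ⟨t, ht, hle⟩ := hr.exists_seminorm_matrixFunction_sub_le hU hz₀ hf hA hv hN p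
  exact ⟨m, hm, hle.trans (hm.2 (Set.mem_image_of_mem _ ht))⟩

theorem corollaryc {n : ℕ} (A : Matrix (Fin n) (Fin n) ℂ) (f : ℂ → ℂ) (z₀ : ℂ) (R : ℝ)
    (hR : 0 < R) (hf : AnalyticOnNhd ℂ f (Metric.ball z₀ R))
    (hA : spectrum ℂ A ⊆ Metric.ball z₀ R)
    (L M : ℕ) (u v : ℂ[X]) (hr : IsPadeApproximant f z₀ L M u v)
    (hv : ∀ μ ∈ spectrum ℂ A, v.eval μ ≠ 0)
    (nrm : Seminorm ℂ (Matrix (Fin n) (Fin n) ℂ)) (hnrm : ∀ B, nrm B = 0 → B = 0)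
    (N : ℕ) (hN : N = L + M + 1) :
    ∃ m : ℝ,
      IsGreatest
        ((fun t : ℝ =>
            nrm ((A - z₀ • (1 : Matrix (Fin n) (Fin n) ℂ)) ^ N * (aeval A v)⁻¹ *
              ((N.factorial : ℂ)⁻¹ •
                matrixFunction (iteratedDeriv N (fun z => v.eval z * f z))
                  ((1 - (t : ℂ)) • (z₀ • (1 : Matrix (Fin n) (Fin n) ℂ)) + (t : ℂ) • A)))) ''
          Set.Icc (0 : ℝ) 1) m ∧
      nrm (matrixFunction f A - matrixFunction (fun z => u.eval z / v.eval z) A) ≤ m := by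
  exact corollaryc_general A f z₀ _ ((convex_ball z₀ R).starConvex (Metric.mem_ball_self hR))
    (Metric.mem_ball_self hR) hf hA L M u v hr hv (nrm.restrictScalars ℝ) N hN
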